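/- Let $\mathbf{C}$ be the Cantor set, let $X$ be a compact metrizable space, and let $f\colon \mathbf{C}\to X$ be a continuous surjection. Let $\varphi\colon C(X)\to C(\mathbf{C})$, $\varphi(g)=g\circ f$, be the induced unital $*$-homomorphism between the C*-algebras of complex-valued continuous functions, and let $\mathrm{K}_0(\varphi)\colon \mathrm{K}_0(C(X))\to \mathrm{K}_0(C(\mathbf{C}))$ be the group homomorphism determined by $[p]_0\mapsto[\varphi(p)]_0$ for projections $p$ in matrix algebras over $C(X)$ ($\varphi$ being applied entrywise). Here, for a unital C*-algebra $A$, $\mathrm{K}_0(A)$ is the Grothendieck group of the abelian monoid of Murray--von Neumann equivalence classes of projections in the matrix algebras $M_n(A)$, $n\ge 1$, with addition $[p]+[q]=[p\oplus q]$. Then the quotient group $$\mathrm{K}_0(C(\mathbf{C}))\,/\,\mathrm{K}_0(\varphi)\bigl(\mathrm{K}_0(C(X))\bigr)$$ is torsion free. If moreover $X$ has covering dimension $\dim(X)=0$, then $\mathrm{K}_0(\varphi)$ is injective. -/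

import Mathlib

open scoped Matrix

/-! ## The group `K₀` of a unital C⋆-algebra

The construction is algebraic and is written for unital ⋆-rings; it is applied to
unital C⋆-algebras, where it is the usual group `K₀`. -/

/-- Murray--von Neumann equivalence of square matrices `p ∈ M_m(A)` and `q ∈ M_n(A)`, possibly of
different sizes: there is `v ∈ M_{n,m}(A)` with `p = v⋆ v` and `q = v v⋆`. -/
def MvNEquiv {A : Type*} [Ring A] [StarRing A] {m n : Type*} [Fintype m] [Fintype n]
    (p : Matrix m m A) (q : Matrix n n A) : Prop :=
  ∃ v : Matrix n m A, vᴴ * v = p ∧ v * vᴴ = q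

namespace MvNEquiv

variable {A : Type*} [Ring A] [StarRing A]
  {m n k l : Type*} [Fintype m] [Fintype n] [Fintype k] [Fintype l]

theorem refl {p : Matrix m m A} (hp : IsStarProjection p) : MvNEquiv p p := by
  have h1 : p * p = p := hp.isIdempotentElem
  have h2 : pᴴ = p := hp.isSelfAdjoint
  exact ⟨p, by rw [h2, h1], by rw [h2, h1]⟩

theorem symm {p : Matrix m m A} {q : Matrix n n A} (h : MvNEquiv p q) : MvNEquiv q p := by
  obtain ⟨v, h1, h2⟩ := h
  exact ⟨vᴴ, by rw [Matrix.conjTranspose_conjTranspose, h2],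
    by rw [Matrix.conjTranspose_conjTranspose, h1]⟩

theorem trans {p : Matrix m m A} {q : Matrix n n A} {r : Matrix k k A}
    (hp : IsStarProjection p) (hr : IsStarProjection r)
    (h : MvNEquiv p q) (h' : MvNEquiv q r) : MvNEquiv p r := by
  obtain ⟨v, h1, h2⟩ := h
  obtain ⟨w, h3, h4⟩ := h'
  have hpp : p * p = p := hp.isIdempotentElem
  have hrr : r * r = r := hr.isIdempotentElem
  refine ⟨w * v, ?_, ?_⟩
  · calc (w * v)ᴴ * (w * v) = vᴴ * (wᴴ * w) * v := by
          simp only [Matrix.conjTranspose_mul, Matrix.mul_assoc]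
      _ = (vᴴ * v) * (vᴴ * v) := by rw [h3, ← h2]; simp only [Matrix.mul_assoc]
      _ = p := by rw [h1, hpp]
  · calc (w * v) * (w * v)ᴴ = w * (v * vᴴ) * wᴴ := by
          simp only [Matrix.conjTranspose_mul, Matrix.mul_assoc]
      _ = (w * wᴴ) * (w * wᴴ) := by rw [h2, ← h3]; simp only [Matrix.mul_assoc]
      _ = r := by rw [h4, hrr]

/-- Renaming the indices of a projection does not change its class. -/
theorem submatrix {p : Matrix m m A} (hp : IsStarProjection p) (e : n ≃ m) :
    MvNEquiv p (p.submatrix e e) := by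
  have h1 : p * p = p := hp.isIdempotentElem
  have h2 : pᴴ = p := hp.isSelfAdjoint
  refine ⟨p.submatrix e id, ?_, ?_⟩
  · rw [Matrix.conjTranspose_submatrix, h2, Matrix.submatrix_mul_equiv, h1, Matrix.submatrix_id_id]
  · have := Matrix.submatrix_mul_equiv p p e (Equiv.refl m) e
    rw [Matrix.conjTranspose_submatrix, h2]
    simpa [h1] using this

theorem fromBlocks {p : Matrix m m A} {p' : Matrix n n A} {q : Matrix k k A} {q' : Matrix l l A}
    (h : MvNEquiv p p') (h' : MvNEquiv q q') :
    MvNEquiv (Matrix.fromBlocks p 0 0 q) (Matrix.fromBlocks p' 0 0 q') := by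
  obtain ⟨v, h1, h2⟩ := h
  obtain ⟨w, h3, h4⟩ := h'
  exact ⟨Matrix.fromBlocks v 0 0 w,
    by simp [Matrix.fromBlocks_conjTranspose, Matrix.fromBlocks_multiply, h1, h3],
    by simp [Matrix.fromBlocks_conjTranspose, Matrix.fromBlocks_multiply, h2, h4]⟩

theorem zero_fromBlocks {p : Matrix m m A} (hp : IsStarProjection p) :
    MvNEquiv (Matrix.fromBlocks (0 : Matrix n n A) 0 0 p) p := by
  have h1 : p * p = p := hp.isIdempotentElem
  have h2 : pᴴ = p := hp.isSelfAdjoint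
  refine ⟨Matrix.fromCols 0 p, ?_, ?_⟩
  · rw [Matrix.conjTranspose_fromCols_eq_fromRows_conjTranspose, Matrix.fromRows_mul_fromCols]
    simp [h1, h2]
  · rw [Matrix.conjTranspose_fromCols_eq_fromRows_conjTranspose, Matrix.fromCols_mul_fromRows]
    simp [h1, h2]

end MvNEquiv

theorem IsStarProjection.matrixSubmatrix {A : Type*} [Ring A] [StarRing A]
    {m n : Type*} [Fintype m] [Fintype n] {p : Matrix m m A} (hp : IsStarProjection p)
    (e : n ≃ m) : IsStarProjection (p.submatrix e e) := by
  have h1 : p * p = p := hp.isIdempotentElem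
  have h2 : pᴴ = p := hp.isSelfAdjoint
  refine ⟨?_, ?_⟩
  · change p.submatrix e e * p.submatrix e e = _
    rw [Matrix.submatrix_mul_equiv, h1]
  · change (p.submatrix e e)ᴴ = _
    rw [Matrix.conjTranspose_submatrix, h2]

theorem IsStarProjection.matrixFromBlocks {A : Type*} [Ring A] [StarRing A]
    {m n : Type*} [Fintype m] [Fintype n] {p : Matrix m m A} {q : Matrix n n A}
    (hp : IsStarProjection p) (hq : IsStarProjection q) :
    IsStarProjection (Matrix.fromBlocks p 0 0 q) := by
  have h1 : p * p = p := hp.isIdempotentElem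
  have h2 : pᴴ = p := hp.isSelfAdjoint
  have h3 : q * q = q := hq.isIdempotentElem
  have h4 : qᴴ = q := hq.isSelfAdjoint
  refine ⟨?_, ?_⟩
  · change Matrix.fromBlocks p 0 0 q * Matrix.fromBlocks p 0 0 q = _
    simp [Matrix.fromBlocks_multiply, h1, h3]
  · change (Matrix.fromBlocks p 0 0 q)ᴴ = _
    simp [Matrix.fromBlocks_conjTranspose, h2, h4]

theorem IsStarProjection.matrixMap {A B : Type*} [Ring A] [StarRing A] [Ring B] [StarRing B]
    [Algebra ℂ A] [Algebra ℂ B] {m : Type*} [Fintype m] {p : Matrix m m A}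
    (hp : IsStarProjection p) (φ : A →⋆ₐ[ℂ] B) : IsStarProjection (p.map φ) := by
  have h1 : p * p = p := hp.isIdempotentElem
  have h2 : pᴴ = p := hp.isSelfAdjoint
  refine ⟨?_, ?_⟩
  · change p.map φ * p.map φ = _
    rw [← Matrix.map_mul, h1]
  · change (p.map φ)ᴴ = _
    rw [← Matrix.conjTranspose_map φ (fun a => map_star φ a), h2]

/-- The set `𝒫_∞(A)`: the disjoint union over `n ≥ 1` of the sets of projections in `M_n(A)`. -/
structure MatrixProj (A : Type*) [Ring A] [StarRing A] where
  /-- The size `n` of the matrix. -/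
  size : ℕ
  size_pos : 0 < size
  /-- The matrix itself. -/
  mat : Matrix (Fin size) (Fin size) A
  isProj : IsStarProjection mat

namespace MatrixProj

variable {A B : Type*} [Ring A] [StarRing A] [Ring B] [StarRing B]

instance setoid (A : Type*) [Ring A] [StarRing A] : Setoid (MatrixProj A) where
  r p q := MvNEquiv p.mat q.mat
  iseqv :=
    { refl := fun p => MvNEquiv.refl p.isProj
      symm := fun h => MvNEquiv.symm h
      trans := fun {p _ r} h h' => MvNEquiv.trans p.isProj r.isProj h h' }

/-- The orthogonal direct sum `p ⊕ q = diag(p, q)`. -/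
def directSum (p q : MatrixProj A) : MatrixProj A where
  size := p.size + q.size
  size_pos := Nat.add_pos_left p.size_pos _
  mat := (Matrix.fromBlocks p.mat 0 0 q.mat).submatrix finSumFinEquiv.symm finSumFinEquiv.symm
  isProj := (p.isProj.matrixFromBlocks q.isProj).matrixSubmatrix _

/-- The zero projection in `M_1(A) = A`. -/
def zero (A : Type*) [Ring A] [StarRing A] : MatrixProj A where
  size := 1
  size_pos := Nat.one_pos
  mat := 0
  isProj := IsStarProjection.zero _

/-- A ⋆-homomorphism applied entrywise. -/
def map [Algebra ℂ A] [Algebra ℂ B] (φ : A →⋆ₐ[ℂ] B) (p : MatrixProj A) : MatrixProj B where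
  size := p.size
  size_pos := p.size_pos
  mat := p.mat.map φ
  isProj := p.isProj.matrixMap φ

theorem directSum_mvn (p q : MatrixProj A) :
    MvNEquiv (Matrix.fromBlocks p.mat 0 0 q.mat) (p.directSum q).mat :=
  MvNEquiv.submatrix (p.isProj.matrixFromBlocks q.isProj) _

theorem equiv_of_blocks {p q : MatrixProj A} {m n : Type*} [Fintype m] [Fintype n]
    {P : Matrix m m A} {Q : Matrix n n A} (hQ : IsStarProjection Q)
    (h1 : MvNEquiv P p.mat) (h2 : MvNEquiv P Q) (h3 : MvNEquiv Q q.mat) : p ≈ q :=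
  MvNEquiv.trans p.isProj q.isProj
    (MvNEquiv.trans p.isProj hQ (MvNEquiv.symm h1) h2) h3

theorem directSum_congr {p p' q q' : MatrixProj A} (h : p ≈ p') (h' : q ≈ q') :
    p.directSum q ≈ p'.directSum q' :=
  equiv_of_blocks (p'.isProj.matrixFromBlocks q'.isProj)
    (directSum_mvn p q) (MvNEquiv.fromBlocks h h') (directSum_mvn p' q')

theorem directSum_comm (p q : MatrixProj A) : p.directSum q ≈ q.directSum p := by
  refine equiv_of_blocks
    (q.isProj.matrixFromBlocks p.isProj) (directSum_mvn p q) ?_ (directSum_mvn q p)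
  have h := MvNEquiv.submatrix (p.isProj.matrixFromBlocks q.isProj)
    (Equiv.sumComm (Fin q.size) (Fin p.size))
  rwa [Equiv.sumComm_apply, Matrix.fromBlocks_submatrix_sum_swap_sum_swap] at h

theorem directSum_assoc (p q r : MatrixProj A) :
    (p.directSum q).directSum r ≈ p.directSum (q.directSum r) := by
  have hp := p.isProj
  have hq := q.isProj
  have hr := r.isProj
  refine equiv_of_blocks (P := Matrix.fromBlocks (Matrix.fromBlocks p.mat 0 0 q.mat) 0 0 r.mat)
    (Q := Matrix.fromBlocks p.mat 0 0 (Matrix.fromBlocks q.mat 0 0 r.mat))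
    (hp.matrixFromBlocks (hq.matrixFromBlocks hr)) ?_ ?_ ?_
  · exact MvNEquiv.trans ((hp.matrixFromBlocks hq).matrixFromBlocks hr)
      ((p.directSum q).directSum r).isProj
      (MvNEquiv.fromBlocks (directSum_mvn p q) (MvNEquiv.refl hr)) (directSum_mvn _ r)
  · have h := MvNEquiv.submatrix ((hp.matrixFromBlocks hq).matrixFromBlocks hr)
      (Equiv.sumAssoc (Fin p.size) (Fin q.size) (Fin r.size)).symm
    convert h using 1
    ext (i | i | i) (j | j | j) <;> rfl
  · exact MvNEquiv.trans (hp.matrixFromBlocks (hq.matrixFromBlocks hr))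
      (p.directSum (q.directSum r)).isProj
      (MvNEquiv.fromBlocks (MvNEquiv.refl hp) (directSum_mvn q r)) (directSum_mvn p _)

theorem zero_directSum (p : MatrixProj A) : (zero A).directSum p ≈ p :=
  equiv_of_blocks p.isProj (directSum_mvn _ p) (MvNEquiv.zero_fromBlocks p.isProj)
    (MvNEquiv.refl p.isProj)

theorem map_congr [Algebra ℂ A] [Algebra ℂ B] (φ : A →⋆ₐ[ℂ] B) {p q : MatrixProj A}
    (h : p ≈ q) : p.map φ ≈ q.map φ := by
  obtain ⟨v, h1, h2⟩ := h
  have hs : (v.map φ)ᴴ = vᴴ.map φ :=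
    (Matrix.conjTranspose_map φ (fun a => map_star φ a)).symm
  have h3 : (v.map φ)ᴴ * v.map φ = p.mat.map φ := by rw [hs, ← Matrix.map_mul, h1]
  have h4 : v.map φ * (v.map φ)ᴴ = q.mat.map φ := by rw [hs, ← Matrix.map_mul, h2]
  exact ⟨v.map φ, h3, h4⟩

theorem map_directSum [Algebra ℂ A] [Algebra ℂ B] (φ : A →⋆ₐ[ℂ] B) (p q : MatrixProj A) :
    (p.directSum q).map φ = (p.map φ).directSum (q.map φ) := by
  have h : ((Matrix.fromBlocks p.mat 0 0 q.mat).submatrix finSumFinEquiv.symm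
      finSumFinEquiv.symm).map φ = (Matrix.fromBlocks (p.mat.map φ) 0 0 (q.mat.map φ)).submatrix
        finSumFinEquiv.symm finSumFinEquiv.symm := by
    rw [← Matrix.submatrix_map, Matrix.fromBlocks_map]
    simp
  unfold map directSum
  congr 1

theorem map_zero [Algebra ℂ A] [Algebra ℂ B] (φ : A →⋆ₐ[ℂ] B) : (zero A).map φ = zero B := by
  simp [map, zero]

end MatrixProj

/-- The abelian monoid `𝒟(A) = 𝒫_∞(A) / ∼` of Murray--von Neumann classes of projections in matrix
algebras over `A`. -/
def ProjClass (A : Type*) [Ring A] [StarRing A] : Type _ := Quotient (MatrixProj.setoid A)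

namespace ProjClass

variable {A B : Type*} [Ring A] [StarRing A] [Ring B] [StarRing B]

/-- The class of a projection. -/
def mk (p : MatrixProj A) : ProjClass A := Quotient.mk _ p

/-- The addition is `[p] + [q] = [p ⊕ q]`. -/
instance (A : Type*) [Ring A] [StarRing A] : Add (ProjClass A) where
  add := Quotient.map₂ MatrixProj.directSum
    (fun _ _ h _ _ h' => MatrixProj.directSum_congr h h')

instance (A : Type*) [Ring A] [StarRing A] : Zero (ProjClass A) where
  zero := mk (MatrixProj.zero A)

instance (A : Type*) [Ring A] [StarRing A] : AddCommMonoid (ProjClass A) where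
  add_assoc := by
    rintro ⟨p⟩ ⟨q⟩ ⟨r⟩
    exact Quotient.sound (MatrixProj.directSum_assoc p q r)
  add_comm := by
    rintro ⟨p⟩ ⟨q⟩
    exact Quotient.sound (MatrixProj.directSum_comm p q)
  zero_add := by
    rintro ⟨p⟩
    exact Quotient.sound (MatrixProj.zero_directSum p)
  add_zero := by
    rintro ⟨p⟩
    exact Quotient.sound
      (Setoid.trans (MatrixProj.directSum_comm p _) (MatrixProj.zero_directSum p))
  nsmul := nsmulRec

/-- The monoid homomorphism `𝒟(A) → 𝒟(B)`, `[p] ↦ [φ(p)]`. -/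
def map [Algebra ℂ A] [Algebra ℂ B] (φ : A →⋆ₐ[ℂ] B) : ProjClass A →+ ProjClass B where
  toFun := Quotient.map (MatrixProj.map φ) (fun _ _ h => MatrixProj.map_congr φ h)
  map_zero' := congrArg mk (MatrixProj.map_zero φ)
  map_add' := by
    rintro ⟨p⟩ ⟨q⟩
    exact congrArg mk (MatrixProj.map_directSum φ p q)

end ProjClass

/-- `K₀(A)` of a unital C⋆-algebra `A`: the Grothendieck group of the monoid of classes of
projections in matrix algebras over `A`. -/
abbrev KZero (A : Type*) [Ring A] [StarRing A] : Type _ :=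
  Algebra.GrothendieckAddGroup (ProjClass A)

namespace KZero

/-- The class `[p]₀ ∈ K₀(A)` of a projection `p ∈ 𝒫_∞(A)`. -/
def cls {A : Type*} [Ring A] [StarRing A] (p : MatrixProj A) : KZero A :=
  Algebra.GrothendieckAddGroup.of (ProjClass.mk p)

/-- The homomorphism `K₀(φ) : K₀(A) → K₀(B)` induced by `φ`, determined by `[p]₀ ↦ [φ(p)]₀`. -/
noncomputable def map {A B : Type*} [Ring A] [StarRing A] [Ring B] [StarRing B]
    [Algebra ℂ A] [Algebra ℂ B] (φ : A →⋆ₐ[ℂ] B) : KZero A →+ KZero B :=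
  Algebra.GrothendieckAddGroup.lift
    ((Algebra.GrothendieckAddGroup.of (M := ProjClass B)).comp (ProjClass.map φ))

theorem map_cls {A B : Type*} [Ring A] [StarRing A] [Ring B] [StarRing B]
    [Algebra ℂ A] [Algebra ℂ B] (φ : A →⋆ₐ[ℂ] B) (p : MatrixProj A) :
    map φ (cls p) = cls (p.map φ) :=
  DFunLike.congr_fun (Algebra.GrothendieckAddGroup.lift.symm_apply_apply
    ((Algebra.GrothendieckAddGroup.of (M := ProjClass B)).comp (ProjClass.map φ)))
    (ProjClass.mk p)

end KZero

/-! ## Covering dimension -/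

/-- `X` has Lebesgue covering dimension `< n`: every finite open cover of `X` has a finite open
refinement (again a cover) such that every point lies in at most `n` of its members. -/
def HasCoveringDimLT (X : Type*) [TopologicalSpace X] (n : ℕ) : Prop :=
  ∀ 𝒰 : Set (Set X), 𝒰.Finite → (∀ U ∈ 𝒰, IsOpen U) → ⋃₀ 𝒰 = Set.univ →
    ∃ 𝒱 : Set (Set X), 𝒱.Finite ∧ (∀ V ∈ 𝒱, IsOpen V) ∧ ⋃₀ 𝒱 = Set.univ ∧
      (∀ V ∈ 𝒱, ∃ U ∈ 𝒰, V ⊆ U) ∧ ∀ x : X, {V ∈ 𝒱 | x ∈ V}.encard ≤ n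

/-- The Lebesgue covering dimension of `X`; it is `⊥` (that is, `-1`) for the empty space and
`⊤` if it is infinite. -/
noncomputable def coveringDim (X : Type*) [TopologicalSpace X] : WithBot ℕ∞ :=
  sInf {d | ∀ n : ℕ, d < n → HasCoveringDimLT X n}

/-! The pointwise trace of a projection over `C(Y)` is its rank, a continuous function to the
integers. This gives a homomorphism from `K₀(C(Y))` to `C(Y, ℤ)`, natural in `Y`. For compact `Y` it
is onto, since continuous integer functions are differences of sums of clopen indicators
(`KZero.exists_trace_eq_intCast`).

For profinite `Y` it is also injective (`KZero.trace_injective`). The range of a projection has a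
unit section over its support (`MatrixProj.exists_unit_section`); splitting off the line it spans
and iterating writes the class as the sum of the indicators of the sets where the rank exceeds `j`.

The theorem thus becomes a statement about `k ↦ k ∘ f` on integer functions. If `n * g = k ∘ f`,
then `g = (k / n) ∘ f` with `k / n` continuous, so the quotient has no torsion. In dimension zero
`X` is itself profinite, so the trace is faithful on both sides, and composing with a surjection is
injective. -/

/-! ### Covers of totally disconnected spaces -/

/-- An open cover of a totally disconnected compact Hausdorff space has a locally constant choice
of a member containing each point. -/
theorem exists_isLocallyConstant_mem {Y ι : Type*} [TopologicalSpace Y] [CompactSpace Y]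
    [T2Space Y] [TotallyDisconnectedSpace Y] {U : ι → Set Y} (hU : ∀ i, IsOpen (U i))
    (hc : ∀ y, ∃ i, y ∈ U i) : ∃ s : Y → ι, IsLocallyConstant s ∧ ∀ y, y ∈ U (s y) := by
  have hcov : TopologicalSpace.IsOpenCover
      (fun i => (⟨U i, hU i⟩ : TopologicalSpace.Opens Y)) := by
    rw [TopologicalSpace.IsOpenCover, eq_top_iff]
    intro y _
    simpa using hc y
  obtain ⟨n, W, h1, h2, h3⟩ := hcov.exists_finite_nonempty_disjoint_clopen_cover
  choose i hi using fun j => (h1 j).2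
  have h4 : ∀ y, ∃ j, y ∈ W j := fun y => by simpa using h2 (Set.mem_univ y)
  choose t ht using h4
  refine ⟨fun y => i (t y), ?_, fun y => hi (t y) (ht y)⟩
  rw [IsLocallyConstant.iff_exists_open]
  refine fun y => ⟨W (t y), (W (t y)).isOpen, ht y, fun z hz => ?_⟩
  by_contra hne
  have hd : Disjoint (W (t z)) (W (t y)) := h3 fun h => hne (congrArg i h)
  rw [← TopologicalSpace.Clopens.coe_disjoint, Set.disjoint_left] at hd
  exact hd (ht z) hz

/-- An infimum below `1` has a member `d < 1` of the defining set beneath that bound, so it need not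
be known that the infimum is attained. -/
theorem hasCoveringDimLT_one_of_coveringDim_eq_zero {X : Type*} [TopologicalSpace X]
    (h : coveringDim X = 0) : HasCoveringDimLT X 1 := by
  have h1 : coveringDim X < 1 := by rw [h]; exact zero_lt_one
  obtain ⟨d, hd, hlt⟩ := sInf_lt_iff.mp h1
  exact hd 1 (by simpa using hlt)

/-- A refinement of order one is a partition into open sets. Applied to the complements of two
distinct points, it yields a member containing `x` but not `y`; that member and the union of the
others separate the points. -/
theorem HasCoveringDimLT.totallyDisconnectedSpace {X : Type*} [TopologicalSpace X] [T1Space X]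
    (h : HasCoveringDimLT X 1) : TotallyDisconnectedSpace X := by
  refine ⟨isTotallyDisconnected_of_isTotallySeparated fun x _ y _ hxy => ?_⟩
  obtain ⟨𝒱, -, hopen, hcov, href, hcard⟩ := h {{x}ᶜ, {y}ᶜ} (by simp)
    (by rintro U (rfl | rfl) <;> exact isOpen_compl_singleton)
    (by
      ext z
      simp only [Set.sUnion_insert, Set.sUnion_singleton, Set.mem_union, Set.mem_compl_iff,
        Set.mem_singleton_iff, Set.mem_univ, iff_true]
      by_contra! hz
      exact hxy (hz.1.symm.trans hz.2))
  have huniq : ∀ z, ∀ V ∈ 𝒱, ∀ W ∈ 𝒱, z ∈ V → z ∈ W → V = W := fun z V hV W hW hzV hzW => by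
    have h1 : {V ∈ 𝒱 | z ∈ V}.encard ≤ 1 := by exact_mod_cast hcard z
    exact Set.encard_le_one_iff.mp h1 V W ⟨hV, hzV⟩ ⟨hW, hzW⟩
  obtain ⟨V, hV, hxV⟩ : ∃ V ∈ 𝒱, x ∈ V := by simpa using hcov.ge (Set.mem_univ x)
  obtain ⟨W, hW, hyW⟩ : ∃ W ∈ 𝒱, y ∈ W := by simpa using hcov.ge (Set.mem_univ y)
  have hyV : y ∉ V := fun hyV => by
    obtain ⟨U, rfl | rfl, hVU⟩ := href V hV
    · exact hVU hxV rfl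
    · exact hVU hyV rfl
  refine ⟨V, ⋃₀ {W ∈ 𝒱 | W ≠ V}, hopen V hV, isOpen_sUnion fun W hW => hopen W hW.1, hxV,
    ⟨W, ⟨hW, fun h => hyV (h ▸ hyW)⟩, hyW⟩, fun z _ => ?_, ?_⟩
  · obtain ⟨T, hT, hzT⟩ : ∃ T ∈ 𝒱, z ∈ T := by simpa using hcov.ge (Set.mem_univ z)
    by_cases hTV : T = V
    · exact Or.inl (hTV ▸ hzT)
    · exact Or.inr ⟨T, ⟨hT, hTV⟩, hzT⟩
  · rw [Set.disjoint_left]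
    rintro z hzV ⟨T, ⟨hT, hTV⟩, hzT⟩
    exact hTV (huniq z T hT V hV hzT hzV)

/-! ### Sums of orthogonal projections -/

/-- The column with blocks `p` and `q` is the partial isometry; orthogonality kills the off-diagonal
blocks. -/
theorem MvNEquiv.add_fromBlocks {A m : Type*} [Ring A] [StarRing A] [Fintype m]
    {p q : Matrix m m A} (hp : IsStarProjection p) (hq : IsStarProjection q) (hpq : p * q = 0)
    (hqp : q * p = 0) : MvNEquiv (p + q) (Matrix.fromBlocks p 0 0 q) := by
  have h1 : p * p = p := hp.isIdempotentElem
  have h2 : pᴴ = p := hp.isSelfAdjoint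
  have h3 : q * q = q := hq.isIdempotentElem
  have h4 : qᴴ = q := hq.isSelfAdjoint
  refine ⟨Matrix.fromRows p q, ?_, ?_⟩
  · rw [Matrix.conjTranspose_fromRows_eq_fromCols_conjTranspose, Matrix.fromCols_mul_fromRows]
    simp [h1, h2, h3, h4]
  · rw [Matrix.conjTranspose_fromRows_eq_fromCols_conjTranspose, Matrix.fromRows_mul_fromCols]
    simp [h1, h2, h3, h4, hpq, hqp]

namespace ProjClass

theorem mk_surjective {A : Type*} [Ring A] [StarRing A] : Function.Surjective (mk (A := A)) :=
  Quotient.exists_rep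

theorem mk_eq_of_mvNEquiv {A : Type*} [Ring A] [StarRing A] {p q : MatrixProj A}
    (h : MvNEquiv p.mat q.mat) : mk p = mk q := Quotient.sound h

theorem mk_eq_zero {A : Type*} [Ring A] [StarRing A] {p : MatrixProj A} (h : p.mat = 0) :
    mk p = 0 :=
  mk_eq_of_mvNEquiv (q := MatrixProj.zero A) ⟨0, by simp [h], Matrix.zero_mul _⟩

/-- If the columns of `ξ` span a subprojection of `p`, it splits off. -/
theorem mk_eq_add_of_mul_eq {A : Type*} [Ring A] [StarRing A] (p e : MatrixProj A)
    (ξ : Matrix (Fin p.size) (Fin e.size) A) (h1 : p.mat * ξ = ξ) (h2 : ξᴴ * ξ = e.mat)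
    (h3 : ξ * e.mat = ξ) :
    ∃ hq : IsStarProjection (p.mat - ξ * ξᴴ),
      mk p = mk e + mk ⟨p.size, p.size_pos, p.mat - ξ * ξᴴ, hq⟩ := by
  have hp1 : p.mat * p.mat = p.mat := p.isProj.isIdempotentElem
  have hp2 : p.matᴴ = p.mat := p.isProj.isSelfAdjoint
  have h4 : ξᴴ * p.mat = ξᴴ := by
    rw [← hp2, ← Matrix.conjTranspose_mul, h1]
  have h5 : (ξ * ξᴴ) * (ξ * ξᴴ) = ξ * ξᴴ := by
    rw [← Matrix.mul_assoc, Matrix.mul_assoc ξ, h2, h3]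
  have h6 : p.mat * (ξ * ξᴴ) = ξ * ξᴴ := by rw [← Matrix.mul_assoc, h1]
  have h7 : (ξ * ξᴴ) * p.mat = ξ * ξᴴ := by rw [Matrix.mul_assoc, h4]
  have hs1 : IsStarProjection (ξ * ξᴴ) := by
    refine ⟨h5, ?_⟩
    change (ξ * ξᴴ)ᴴ = _
    simp
  have hs2 : IsStarProjection (p.mat - ξ * ξᴴ) := by
    refine ⟨?_, ?_⟩
    · change (p.mat - ξ * ξᴴ) * (p.mat - ξ * ξᴴ) = _
      simp only [sub_mul, mul_sub, hp1, h5, h6, h7]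
      simp
    · change (p.mat - ξ * ξᴴ)ᴴ = _
      simp [hp2]
  let q : MatrixProj A := ⟨p.size, p.size_pos, p.mat - ξ * ξᴴ, hs2⟩
  refine ⟨hs2, ?_⟩
  change _ = mk (e.directSum q)
  refine Quotient.sound (MatrixProj.equiv_of_blocks (P := p.mat) (e.isProj.matrixFromBlocks hs2)
    (MvNEquiv.refl p.isProj) ?_ (MatrixProj.directSum_mvn e q))
  -- `p` is the orthogonal sum of `ξ * ξᴴ` and its complement in `p`, and `ξᴴ` implements the
  -- equivalence of `ξ * ξᴴ` with `e`.
  have h8 : MvNEquiv p.mat (Matrix.fromBlocks (ξ * ξᴴ) 0 0 (p.mat - ξ * ξᴴ)) := by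
    have := MvNEquiv.add_fromBlocks hs1 hs2 (by rw [mul_sub, h7, h5, sub_self])
      (by rw [sub_mul, h6, h5, sub_self])
    rwa [add_sub_cancel] at this
  exact h8.trans p.isProj (e.isProj.matrixFromBlocks hs2)
    (MvNEquiv.fromBlocks ⟨ξᴴ, by simp, by simpa using h2⟩ (MvNEquiv.refl hs2))

end ProjClass

/-! ### The trace -/

namespace ProjClass

/-- The trace, as a homomorphism on classes of projections over a commutative ring. -/
def trace (A : Type*) [CommRing A] [StarRing A] : ProjClass A →+ A where
  toFun := Quotient.lift (fun p : MatrixProj A => p.mat.trace) (by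
    rintro p q ⟨v, h1, h2⟩
    rw [← h1, ← h2, Matrix.trace_mul_comm])
  map_zero' := Matrix.trace_zero _ _
  map_add' := by
    rintro ⟨p⟩ ⟨q⟩
    change ((Matrix.fromBlocks p.mat 0 0 q.mat).submatrix finSumFinEquiv.symm
      finSumFinEquiv.symm).trace = p.mat.trace + q.mat.trace
    refine (finSumFinEquiv.symm.sum_comp
      fun i => Matrix.fromBlocks p.mat 0 0 q.mat i i).trans ?_
    rw [Fintype.sum_sum_type]
    rfl

theorem trace_mk {A : Type*} [CommRing A] [StarRing A] (p : MatrixProj A) :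
    trace A (mk p) = p.mat.trace := rfl

end ProjClass

namespace KZero

/-- The homomorphism `K₀(A) → A` induced by the trace, for a commutative ring `A`. -/
noncomputable def trace (A : Type*) [CommRing A] [StarRing A] : KZero A →+ A :=
  Algebra.GrothendieckAddGroup.lift (ProjClass.trace A)

theorem trace_of {A : Type*} [CommRing A] [StarRing A] (a : ProjClass A) :
    trace A (Algebra.GrothendieckAddGroup.of a) = ProjClass.trace A a :=
  DFunLike.congr_fun (Algebra.GrothendieckAddGroup.lift.symm_apply_apply (ProjClass.trace A)) a

theorem map_of {A B : Type*} [Ring A] [StarRing A] [Ring B] [StarRing B] [Algebra ℂ A]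
    [Algebra ℂ B] (φ : A →⋆ₐ[ℂ] B) (a : ProjClass A) :
    map φ (Algebra.GrothendieckAddGroup.of a) =
      Algebra.GrothendieckAddGroup.of (ProjClass.map φ a) :=
  DFunLike.congr_fun (Algebra.GrothendieckAddGroup.lift.symm_apply_apply
    ((Algebra.GrothendieckAddGroup.of (M := ProjClass B)).comp (ProjClass.map φ))) a

theorem exists_of_sub_of {A : Type*} [Ring A] [StarRing A] (x : KZero A) :
    ∃ a b : ProjClass A,
      x = Algebra.GrothendieckAddGroup.of a - Algebra.GrothendieckAddGroup.of b := by
  induction x using AddLocalization.ind with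
  | _ y =>
    obtain ⟨a, b, hb⟩ := y
    refine ⟨a, b, ?_⟩
    rw [eq_sub_iff_add_eq, AddLocalization.mk_eq_addMonoidOf_mk']
    exact (AddLocalization.addMonoidOf ⊤).mk'_spec a ⟨b, hb⟩

/-- The trace is natural. -/
theorem trace_map {A B : Type*} [CommRing A] [StarRing A] [CommRing B] [StarRing B] [Algebra ℂ A]
    [Algebra ℂ B] (φ : A →⋆ₐ[ℂ] B) (x : KZero A) : trace B (map φ x) = φ (trace A x) := by
  have h : ∀ a, ProjClass.trace B (ProjClass.map φ a) = φ (ProjClass.trace A a) := by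
    rintro ⟨p⟩
    exact (AddMonoidHom.map_trace φ p.mat).symm
  obtain ⟨a, b, rfl⟩ := exists_of_sub_of x
  simp only [map_sub, map_of, trace_of, h]

end KZero

/-! ### Projections over `C(Y)` -/

theorem Continuous.isClopen_setOf_lt {Y : Type*} [TopologicalSpace Y] {h : Y → ℕ}
    (hc : Continuous h) (j : ℕ) : IsClopen {y | j < h y} :=
  (isClopen_discrete (Set.Ioi j)).preimage hc

namespace MatrixProj

variable {Y : Type*} [TopologicalSpace Y]

/-- The value of a projection over `C(Y)` at a point. -/
noncomputable def fiber (p : MatrixProj C(Y, ℂ)) (y : Y) : Matrix (Fin p.size) (Fin p.size) ℂ :=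
  p.mat.map fun g => g y

/-- The rank function of a projection over `C(Y)`. -/
noncomputable def rank (p : MatrixProj C(Y, ℂ)) (y : Y) : ℕ := (p.fiber y).rank

theorem fiber_mul_self (p : MatrixProj C(Y, ℂ)) (y : Y) : p.fiber y * p.fiber y = p.fiber y := by
  have h : p.mat * p.mat = p.mat := p.isProj.isIdempotentElem
  ext i j
  have := DFunLike.congr_fun (congrFun (congrFun h i) j) y
  simpa [Matrix.mul_apply, fiber, ContinuousMap.sum_apply] using this

theorem conjTranspose_fiber (p : MatrixProj C(Y, ℂ)) (y : Y) : (p.fiber y)ᴴ = p.fiber y := by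
  have h : p.matᴴ = p.mat := p.isProj.isSelfAdjoint
  ext i j
  exact DFunLike.congr_fun (congrFun (congrFun h i) j) y

/-- The trace of an idempotent is the dimension of its range. -/
theorem trace_apply (p : MatrixProj C(Y, ℂ)) (y : Y) : p.mat.trace y = p.rank y := by
  have h : IsIdempotentElem (Matrix.toLin' (p.fiber y)) := by
    rw [IsIdempotentElem, Module.End.mul_eq_comp, ← Matrix.toLin'_mul, fiber_mul_self]
  have h1 := (LinearMap.IsIdempotentElem.isProj_range _ h).trace
  rw [Matrix.trace_toLin'_eq] at h1
  rw [rank, Matrix.rank, ← Matrix.toLin'_apply', ← h1]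
  simp [Matrix.trace, fiber, ContinuousMap.sum_apply]

theorem fiber_eq_zero (p : MatrixProj C(Y, ℂ)) {y : Y} (h : p.rank y = 0) : p.fiber y = 0 := by
  rw [rank, Matrix.rank, Submodule.finrank_eq_zero, LinearMap.range_eq_bot] at h
  exact Matrix.toLin'.map_eq_zero_iff.mp h

/-- The rank is a continuous real function, being the trace, and `ℕ` carries the topology induced
from `ℝ`. -/
theorem continuous_rank (p : MatrixProj C(Y, ℂ)) : Continuous p.rank := by
  have h : Continuous fun y => (p.mat.trace y).re := by fun_prop
  simp only [trace_apply, Complex.natCast_re] at h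
  exact Nat.isClosedEmbedding_coe_real.isEmbedding.continuous_iff.mpr h

theorem rank_le (p : MatrixProj C(Y, ℂ)) (y : Y) : p.rank y ≤ p.size := 
  (p.fiber y).rank_le_width

theorem isClopen_lt_rank (p : MatrixProj C(Y, ℂ)) (j : ℕ) : IsClopen {y | j < p.rank y} :=
  Continuous.isClopen_setOf_lt p.continuous_rank j

/-- The characteristic function of a clopen set as a projection in `M_1(C(Y))`. -/
noncomputable abbrev indicator (E : Set Y) (hE : IsClopen E) : MatrixProj C(Y, ℂ) where
  size := 1
  size_pos := Nat.one_pos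
  mat := Matrix.of fun _ _ => (LocallyConstant.charFn ℂ hE : C(Y, ℂ))
  isProj := by
    refine ⟨?_, ?_⟩
    · ext i j y
      by_cases hy : y ∈ E <;> simp [Matrix.mul_apply, LocallyConstant.coe_charFn, hy]
    · ext i j y
      by_cases hy : y ∈ E <;> simp [Matrix.star_apply, LocallyConstant.coe_charFn, hy]

theorem indicator_mat_apply {E : Set Y} (hE : IsClopen E) (i j : Fin 1) (y : Y) :
    (indicator E hE).mat i j y = E.indicator 1 y := by
  simp [LocallyConstant.coe_charFn]

theorem trace_indicator {E : Set Y} (hE : IsClopen E) (y : Y) :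
    (indicator E hE).mat.trace y = E.indicator 1 y := by
  rw [← indicator_mat_apply hE 0 0]
  exact DFunLike.congr_fun (Matrix.trace_fin_one (indicator E hE).mat) y

theorem indicator_congr {E F : Set Y} (hE : IsClopen E) (hF : IsClopen F) (h : E = F) :
    indicator E hE = indicator F hF := by
  subst h; rfl

end MatrixProj

/-! ### Unit sections of the range of a projection -/

namespace MatrixProj

variable {Y : Type*} [TopologicalSpace Y]

theorem star_fiber_apply (p : MatrixProj C(Y, ℂ)) (y : Y) (i j : Fin p.size) :
    star (p.fiber y i j) = p.fiber y j i :=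
  congrFun (congrFun (p.conjTranspose_fiber y) j) i

theorem sum_fiber_mul_fiber (p : MatrixProj C(Y, ℂ)) (y : Y) (i j : Fin p.size) :
    ∑ k, p.fiber y i k * p.fiber y k j = p.fiber y i j := by
  rw [← Matrix.mul_apply, fiber_mul_self]

theorem fiber_diag_eq_ofReal (p : MatrixProj C(Y, ℂ)) (y : Y) (i : Fin p.size) :
    p.fiber y i i = ((p.fiber y i i).re : ℂ) :=
  (Complex.conj_eq_iff_re.mp (p.star_fiber_apply y i i)).symm

/-- Since the fibre is a self-adjoint idempotent, its diagonal entry is the squared norm of the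
corresponding column. -/
theorem re_fiber_diag_nonneg (p : MatrixProj C(Y, ℂ)) (y : Y) (i : Fin p.size) :
    0 ≤ (p.fiber y i i).re := by
  rw [← p.sum_fiber_mul_fiber, Complex.re_sum]
  refine Finset.sum_nonneg fun k _ => ?_
  rw [← p.star_fiber_apply y k i, ← starRingEnd_apply, ← Complex.normSq_eq_conj_mul_self]
  simpa using Complex.normSq_nonneg _

theorem exists_fiber_diag_ne_zero (p : MatrixProj C(Y, ℂ)) {y : Y} (h : p.rank y ≠ 0) :
    ∃ i, p.fiber y i i ≠ 0 := by
  by_contra! h0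
  have h1 := p.trace_apply y
  rw [Matrix.trace, ContinuousMap.sum_apply,
    Finset.sum_eq_zero fun i _ => show p.mat.diag i y = 0 from h0 i] at h1
  exact h (by exact_mod_cast h1.symm)

theorem continuous_fiber_apply (p : MatrixProj C(Y, ℂ)) (i j : Fin p.size) :
    Continuous fun y => p.fiber y i j := (p.mat i j).continuous

/-- Over a profinite space the range of a projection has a section of norm one on the support of
the projection. -/
theorem exists_unit_section [CompactSpace Y] [T2Space Y] [TotallyDisconnectedSpace Y]
    (p : MatrixProj C(Y, ℂ)) :
    ∃ ξ : Matrix (Fin p.size) (Fin 1) C(Y, ℂ), p.mat * ξ = ξ ∧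
      ξᴴ * ξ = (indicator _ (p.isClopen_lt_rank 0)).mat ∧
      ξ * (indicator _ (p.isClopen_lt_rank 0)).mat = ξ := by
  -- Choose, locally constantly, an index whose column is nonzero. The open zero locus of the rank
  -- is added to every member so that the sets cover `Y`.
  obtain ⟨s, hs, hsU⟩ : ∃ s : Y → Fin p.size, IsLocallyConstant s ∧
      ∀ y, y ∈ {y | p.fiber y (s y) (s y) ≠ 0} ∪ {y | p.rank y = 0} := by
    refine exists_isLocallyConstant_mem
      (U := fun i => {y | p.fiber y i i ≠ 0} ∪ {y | p.rank y = 0}) (fun i => ?_) fun y => ?_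
    · exact (isOpen_ne_fun (p.continuous_fiber_apply i i) continuous_const).union
        ((isOpen_discrete {0}).preimage p.continuous_rank)
    · by_cases hy : p.rank y = 0
      · exact ⟨⟨0, p.size_pos⟩, Or.inr hy⟩
      · exact (p.exists_fiber_diag_ne_zero hy).imp fun i hi => Or.inl hi
  -- `c y` is the norm of column `s y` of the fibre; the section is that column divided by `c y`.
  -- Off the support division by zero gives the value `0`, which stays continuous because the
  -- support is clopen.
  let c : Y → ℂ := fun y => (√(p.fiber y (s y) (s y)).re : ℂ)
  have hc2 : ∀ y, c y * c y = p.fiber y (s y) (s y) := fun y => by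
    rw [p.fiber_diag_eq_ofReal y (s y), ← Complex.ofReal_mul,
      Real.mul_self_sqrt (p.re_fiber_diag_nonneg y (s y))]
  have hc0 : ∀ y, p.rank y ≠ 0 → c y ≠ 0 := fun y hy h => by
    have h1 := hc2 y
    rw [h, mul_zero] at h1
    exact (hsU y).elim (fun h2 => h2 h1.symm) hy
  have hcont : ∀ k, Continuous fun y => p.fiber y k (s y) / c y := fun k => by
    rw [continuous_iff_continuousAt]
    intro y
    by_cases hy : p.rank y = 0
    · refine (continuousAt_const (y := (0 : ℂ))).congr ?_
      filter_upwards [((isOpen_discrete {0}).preimage p.continuous_rank).mem_nhds hy] with z hz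
      rw [p.fiber_eq_zero hz]
      simp
    · have h1 : ContinuousAt
          (fun z => p.fiber z k (s y) / (√(p.fiber z (s y) (s y)).re : ℂ)) y := by
        refine (p.continuous_fiber_apply k (s y)).continuousAt.div ?_ (hc0 y hy)
        exact (Complex.continuous_ofReal.comp (Real.continuous_sqrt.comp
          (Complex.continuous_re.comp (p.continuous_fiber_apply (s y) (s y))))).continuousAt
      refine h1.congr ?_
      filter_upwards [hs.eventually_eq y] with z hz
      simp only [c, hz]
  refine ⟨Matrix.of fun k _ => ⟨_, hcont k⟩, ?_, ?_, ?_⟩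
  · ext k j y
    simp only [Matrix.mul_apply, Matrix.of_apply, ContinuousMap.sum_apply, ContinuousMap.mul_apply,
      ContinuousMap.coe_mk, ← mul_div_assoc]
    rw [← Finset.sum_div]
    exact congrArg (· / c y) (p.sum_fiber_mul_fiber y k (s y))
  · ext i j y
    have h1 : star (c y) = c y := Complex.conj_ofReal _
    rw [indicator_mat_apply]
    simp only [Matrix.mul_apply, Matrix.of_apply, Matrix.conjTranspose_apply,
      ContinuousMap.sum_apply, ContinuousMap.mul_apply, ContinuousMap.star_apply,
      ContinuousMap.coe_mk, star_div₀, h1, p.star_fiber_apply, div_mul_div_comm]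
    rw [← Finset.sum_div, p.sum_fiber_mul_fiber, hc2]
    by_cases hy : p.rank y = 0
    · simp [hy, p.fiber_eq_zero hy]
    · rw [← hc2, div_self (mul_ne_zero (hc0 y hy) (hc0 y hy))]
      simp [Nat.pos_of_ne_zero hy]
  · ext k j y
    simp only [Matrix.mul_apply, Finset.univ_unique, Finset.sum_singleton,
      ContinuousMap.mul_apply]
    by_cases hy : p.rank y = 0
    · simp [p.fiber_eq_zero hy]
    · simp [LocallyConstant.coe_charFn, Nat.pos_of_ne_zero hy]

end MatrixProj

/-! ### Classes of projections and rank functions -/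

namespace ProjClass

variable {Y : Type*} [TopologicalSpace Y]

/-- Over a profinite space the class of a projection is determined by its rank function. -/
theorem mk_eq_sum_indicator [CompactSpace Y] [T2Space Y] [TotallyDisconnectedSpace Y] {N : ℕ}
    (p : MatrixProj C(Y, ℂ)) (hN : ∀ y, p.rank y ≤ N) :
    mk p = ∑ j ∈ Finset.range N, mk (.indicator _ (p.isClopen_lt_rank j)) := by
  induction N generalizing p with
  | zero =>
    refine mk_eq_zero ?_
    ext i j y
    exact congrFun (congrFun (p.fiber_eq_zero (Nat.le_zero.mp (hN y))) i) j
  | succ N ih =>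
    obtain ⟨ξ, h1, h2, h3⟩ := p.exists_unit_section
    obtain ⟨hq, h4⟩ := mk_eq_add_of_mul_eq p (.indicator _ (p.isClopen_lt_rank 0)) ξ h1 h2 h3
    -- The complement `q` has rank one less wherever `p` is nonzero, so the set where its rank
    -- exceeds `j` is the one where the rank of `p` exceeds `j + 1`.
    set q : MatrixProj C(Y, ℂ) := ⟨p.size, p.size_pos, p.mat - ξ * ξᴴ, hq⟩
    have h5 : ∀ y, p.rank y = q.rank y + {y | 0 < p.rank y}.indicator 1 y := fun y => by
      have h6 : p.mat.trace y = q.mat.trace y +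
          (MatrixProj.indicator _ (p.isClopen_lt_rank 0)).mat.trace y := by
        rw [← h2, ← Matrix.trace_mul_comm ξ, ← ContinuousMap.add_apply, ← Matrix.trace_add,
          sub_add_cancel]
      rw [MatrixProj.trace_indicator, MatrixProj.trace_apply, MatrixProj.trace_apply] at h6
      by_cases hy : 0 < p.rank y <;> simp [hy] at h6 ⊢ <;> exact_mod_cast h6
    have h7 : ∀ y j, j < q.rank y ↔ j + 1 < p.rank y := fun y j => by
      have := h5 y
      by_cases hy : 0 < p.rank y <;> simp [hy] at this <;> omega
    have h8 : ∀ y, q.rank y ≤ N := fun y => by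
      have := h7 y N
      have := hN y
      omega
    rw [h4, ih q h8, Finset.sum_range_succ', add_comm]
    congr 1
    refine Finset.sum_congr rfl fun j _ => congrArg mk (MatrixProj.indicator_congr _ _ ?_)
    ext y
    exact h7 y j

theorem trace_injective (Y : Type*) [TopologicalSpace Y] [CompactSpace Y] [T2Space Y]
    [TotallyDisconnectedSpace Y] : Function.Injective (trace C(Y, ℂ)) := by
  rintro ⟨p⟩ ⟨q⟩ h
  change p.mat.trace = q.mat.trace at h
  have hr : p.rank = q.rank := by
    funext y
    have := DFunLike.congr_fun h y
    rw [p.trace_apply, q.trace_apply] at this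
    exact_mod_cast this
  -- The bound `p.size` is used for both projections, so that the two sums have the same length.
  refine (mk_eq_sum_indicator p p.rank_le).trans
    (Eq.trans ?_ (mk_eq_sum_indicator q fun y => hr ▸ p.rank_le y).symm)
  exact Finset.sum_congr rfl fun j _ => congrArg mk (MatrixProj.indicator_congr _ _ (by rw [hr]))

/-- Layer-cake decomposition: `h` is the sum over `j` of the indicators of the clopen sets `{j <
h}`, and compactness makes the sum finite. -/
theorem exists_trace_eq_natCast [CompactSpace Y] {h : Y → ℕ} (hc : Continuous h) :
    ∃ a : ProjClass C(Y, ℂ), ∀ y, trace _ a y = h y := by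
  obtain ⟨N, hN⟩ := (isCompact_range hc).bddAbove
  have hN' : ∀ y, h y ≤ N := fun y => hN ⟨y, rfl⟩
  refine ⟨∑ j ∈ Finset.range N, mk (.indicator _ (hc.isClopen_setOf_lt j)), fun y => ?_⟩
  have h1 : ∀ j, trace _ (mk (.indicator _ (hc.isClopen_setOf_lt j))) y =
      if j < h y then (1 : ℂ) else 0 := fun j =>
    (MatrixProj.trace_indicator (hc.isClopen_setOf_lt j) y).trans (Set.indicator_apply _ _ _)
  have : (Finset.range N).filter (· < h y) = Finset.range (h y) := by
    ext j
    have := hN' y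
    simp only [Finset.mem_filter, Finset.mem_range]
    omega
  rw [map_sum, ContinuousMap.sum_apply, Finset.sum_congr rfl fun j _ => h1 j, Finset.sum_boole,
    this, Finset.card_range]

end ProjClass

/-! ### `K₀` as a group of integer-valued functions -/

namespace KZero

theorem trace_injective (Y : Type*) [TopologicalSpace Y] [CompactSpace Y] [T2Space Y]
    [TotallyDisconnectedSpace Y] : Function.Injective (trace C(Y, ℂ)) := by
  rw [injective_iff_map_eq_zero]
  intro x hx
  obtain ⟨a, b, rfl⟩ := exists_of_sub_of x
  rw [map_sub, trace_of, trace_of, sub_eq_zero] at hx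
  rw [ProjClass.trace_injective Y hx, sub_self]

theorem exists_trace_eq_intCast {Y : Type*} [TopologicalSpace Y] [CompactSpace Y] {g : Y → ℤ}
    (hg : Continuous g) : ∃ x : KZero C(Y, ℂ), ∀ y, trace _ x y = g y := by
  obtain ⟨a, ha⟩ := ProjClass.exists_trace_eq_natCast (h := fun y => (g y).toNat)
    ((continuous_of_discreteTopology (f := Int.toNat)).comp hg)
  obtain ⟨b, hb⟩ := ProjClass.exists_trace_eq_natCast (h := fun y => (-g y).toNat)
    ((continuous_of_discreteTopology (f := fun n : ℤ => (-n).toNat)).comp hg)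
  refine ⟨Algebra.GrothendieckAddGroup.of a - Algebra.GrothendieckAddGroup.of b, fun y => ?_⟩
  rw [map_sub, trace_of, trace_of, ContinuousMap.sub_apply, ha, hb]
  exact_mod_cast congrArg (Int.cast : ℤ → ℂ) (Int.toNat_sub_toNat_neg (g y))

theorem exists_intCast_eq_trace {Y : Type*} [TopologicalSpace Y] (x : KZero C(Y, ℂ)) :
    ∃ g : Y → ℤ, Continuous g ∧ ∀ y, trace _ x y = g y := by
  obtain ⟨a, b, rfl⟩ := exists_of_sub_of x
  obtain ⟨p, rfl⟩ := ProjClass.mk_surjective a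
  obtain ⟨q, rfl⟩ := ProjClass.mk_surjective b
  refine ⟨fun y => (p.rank y : ℤ) - q.rank y,
    ((continuous_of_discreteTopology (f := fun n : ℕ => (n : ℤ))).comp p.continuous_rank).sub
      ((continuous_of_discreteTopology (f := fun n : ℕ => (n : ℤ))).comp q.continuous_rank), fun y => ?_⟩
  rw [map_sub, trace_of, trace_of, ContinuousMap.sub_apply, ProjClass.trace_mk,
    ProjClass.trace_mk, p.trace_apply, q.trace_apply]
  push_cast
  rfl

/-- For a continuous map `f : Y → X` with `Y` profinite, the image of `K₀(C(X))` is a pure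
subgroup of `K₀(C(Y))`. -/
theorem mem_range_map_of_nsmul_mem {X Y : Type*} [TopologicalSpace X] [CompactSpace X]
    [TopologicalSpace Y] [CompactSpace Y] [T2Space Y] [TotallyDisconnectedSpace Y]
    (f : C(Y, X)) {n : ℕ} (hn : n ≠ 0) {w : KZero C(Y, ℂ)}
    (h : n • w ∈ (map (ContinuousMap.compStarAlgHom' ℂ ℂ f : C(X, ℂ) →⋆ₐ[ℂ] C(Y, ℂ))).range) :
    w ∈ (map (ContinuousMap.compStarAlgHom' ℂ ℂ f : C(X, ℂ) →⋆ₐ[ℂ] C(Y, ℂ))).range := by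
  obtain ⟨x, hx⟩ := h
  obtain ⟨g, -, hg⟩ := exists_intCast_eq_trace w
  obtain ⟨k, hk, hk'⟩ := exists_intCast_eq_trace x
  have h1 : ∀ y, k (f y) = n * g y := fun y => by
    have h2 := DFunLike.congr_fun (congrArg (trace _) hx) y
    rw [trace_map, map_nsmul] at h2
    have h3 : trace _ x (f y) = n • trace _ w y := h2
    rw [hk', hg, nsmul_eq_mul] at h3
    exact_mod_cast h3
  -- Integer division keeps the quotient continuous on all of `X`; it is exact on the range of `f`,
  -- which is all that matters after composing with `f`.
  obtain ⟨z, hz⟩ := exists_trace_eq_intCast (g := fun t => k t / n)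
    ((continuous_of_discreteTopology (f := fun m : ℤ => m / n)).comp hk)
  refine ⟨z, trace_injective Y ?_⟩
  ext y
  rw [trace_map, hg]
  change trace _ z (f y) = _
  rw [hz, h1, Int.mul_ediv_cancel_left _ (by exact_mod_cast hn)]

/-- By naturality the traces of `x` and `x'` agree after composition with `f`, hence agree on `X`,
where the trace is faithful. -/
theorem map_injective_of_surjective {X Y : Type*} [TopologicalSpace X] [CompactSpace X]
    [T2Space X] [TotallyDisconnectedSpace X] [TopologicalSpace Y] (f : C(Y, X))
    (hf : Function.Surjective f) : Function.Injective
      (map (ContinuousMap.compStarAlgHom' ℂ ℂ f : C(X, ℂ) →⋆ₐ[ℂ] C(Y, ℂ))) := by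
  intro x x' h
  refine trace_injective X ?_
  have h1 := congrArg (trace _) h
  rw [trace_map, trace_map] at h1
  ext t
  obtain ⟨y, rfl⟩ := hf t
  exact DFunLike.congr_fun h1 y

end KZero

theorem proposition4p2 {X : Type*} [TopologicalSpace X] [CompactSpace X]
    [TopologicalSpace.MetrizableSpace X] (f : C(cantorSet, X)) (hf : Function.Surjective f) :
    IsAddTorsionFree (KZero C(cantorSet, ℂ) ⧸
      (KZero.map (ContinuousMap.compStarAlgHom' ℂ ℂ f : C(X, ℂ) →⋆ₐ[ℂ] C(cantorSet, ℂ))).range) ∧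
    (coveringDim X = 0 → Function.Injective
      (KZero.map (ContinuousMap.compStarAlgHom' ℂ ℂ f : C(X, ℂ) →⋆ₐ[ℂ] C(cantorSet, ℂ)))) := by
  have : CompactSpace cantorSet := isCompact_iff_compactSpace.mp isCompact_cantorSet
  have : TotallyDisconnectedSpace cantorSet :=
    cantorSetHomeomorphNatToBool.symm.totallyDisconnectedSpace
  refine ⟨⟨fun n hn => ?_⟩, fun hX => ?_⟩
  · rintro ⟨a⟩ ⟨b⟩ h
    refine QuotientAddGroup.eq.mpr (KZero.mem_range_map_of_nsmul_mem f hn ?_)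
    -- Equality of the cosets of `n • a` and `n • b` says that `n • (-a + b)` lies in the range, and
    -- purity removes the factor `n`.
    rw [nsmul_add, smul_neg]
    exact QuotientAddGroup.eq.mp h
  · have := (hasCoveringDimLT_one_of_coveringDim_eq_zero hX).totallyDisconnectedSpace
    exact KZero.map_injective_of_surjective f hf
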